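/- Let $G$ be a finite simple graph with nonempty vertex set $V(G)=\{t_1,\ldots,t_s\}$ and without isolated vertices, let $c_0$ be the number of bipartite connected components of $G$, and let $\mathcal{P}\subset\mathbb{R}^s$ be the convex hull of all $e_i+e_j$ such that $\{t_i,t_j\}$ is an edge of $G$, where $e_i$ is the $i$-th unit vector. Let $K$ be a field of characteristic zero and let $w=c\,t_1^{b_1}\cdots t_s^{b_s}\in K[t_1,\ldots,t_s]$, with $c\in K\setminus\{0\}$ and $b_i\in\mathbb{N}$, be a monomial. Then the weighted Ehrhart function $$ E_\mathcal{P}^w\colon\mathbb{N}\to K,\qquad E_\mathcal{P}^w(n)=\sum_{\alpha\in n\mathcal{P}\cap\mathbb{Z}^s}w(\alpha), $$ is a polynomial in $n$, that is, there is $f\in K[x]$ with $E_\mathcal{P}^w(n)=f(n)$ for all integers $n\ge 0$; and $f$ is non-zero of degree $$ \deg(E_\mathcal{P}^w)=s-c_0-1+\deg(w). $$ -/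

import Mathlib

open scoped Pointwise

noncomputable section

/-- The edge polytope of `G`: the convex hull in `ℝ^V` of all `e_i + e_j` with `{i, j}` an edge. -/
def edgePolytope {V : Type*} [DecidableEq V] (G : SimpleGraph V) : Set (V → ℝ) :=
  convexHull ℝ {x | ∃ i j : V, G.Adj i j ∧ x = Pi.single i 1 + Pi.single j 1}

/-- The integer points of the dilate `n • P`, that is, `nP ∩ ℤ^V`. -/
def dilateLatticePoints {V : Type*} (P : Set (V → ℝ)) (n : ℕ) : Set (V → ℤ) :=
  {a | (fun i => (a i : ℝ)) ∈ (n : ℝ) • P}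

/-- The weighted Ehrhart function `E_P^w(n) = ∑_{a ∈ nP ∩ ℤ^V} w(a)` of a bounded set `P`. -/
def weightedEhrhart {V K : Type*} [Field K] (P : Set (V → ℝ)) (w : MvPolynomial V K) (n : ℕ) : K :=
  ∑ᶠ a ∈ dilateLatticePoints P n, MvPolynomial.eval (fun i => (a i : K)) w

/-- The number `c₀` of bipartite connected components of `G`. -/
def numBipartiteComponents {V : Type*} (G : SimpleGraph V) : ℕ :=
  Nat.card {C : G.ConnectedComponent // C.toSimpleGraph.IsBipartite}

/-- The sum defining `weightedEhrhart` is a finite sum as soon as `P` is bounded. -/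
theorem dilateLatticePoints_finite {V : Type*} [Fintype V] {P : Set (V → ℝ)}
    (hP : Bornology.IsBounded P) (n : ℕ) : (dilateLatticePoints P n).Finite := by
  classical
  obtain ⟨R, hR⟩ := (hP.smul₀ (n : ℝ)).exists_norm_le
  refine (Set.finite_Icc (fun _ : V => -⌈R⌉) (fun _ => ⌈R⌉)).subset fun a ha => ?_
  have h : ∀ i, |(a i : ℝ)| ≤ R := fun i => (norm_le_pi_norm (fun i => (a i : ℝ)) i).trans (hR _ ha)
  refine ⟨fun i => ?_, fun i => ?_⟩
  · have h1 := (abs_le.1 (h i)).1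
    have h2 := Int.le_ceil R
    have h3 : ((-⌈R⌉ : ℤ) : ℝ) ≤ (a i : ℝ) := by push_cast; linarith
    exact_mod_cast h3
  · have h1 := (abs_le.1 (h i)).2
    have h2 := Int.le_ceil R
    have h3 : (a i : ℝ) ≤ ((⌈R⌉ : ℤ) : ℝ) := by linarith
    exact_mod_cast h3

/-- The edge polytope of a finite graph is bounded. -/
theorem edgePolytope_isBounded {V : Type*} [Fintype V] [DecidableEq V] (G : SimpleGraph V) :
    Bornology.IsBounded (edgePolytope G) := by
  refine isBounded_convexHull.2 (Set.Finite.isBounded ?_)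
  refine (Set.finite_range
    (fun p : V × V => (Pi.single p.1 1 + Pi.single p.2 1 : V → ℝ))).subset ?_
  rintro x ⟨i, j, -, rfl⟩
  exact ⟨(i, j), rfl⟩

end

/-! Half the coordinate sum equals 1 on every vertex of the polytope, so a point of the cone over it
has a height, and all its representations by the vertices have coefficient sum equal to that height.
Each point has a unique lexicographically largest nonnegative representation. Its support is
linearly independent, and the supports form a triangulation in which every simplex can be joined
with vertex 0.

Splitting coefficients into integral and fractional parts writes each lattice point uniquely as one
of finitely many box points `r` plus a natural combination of the vertices in `apexSupport r`
(`sum_dilateLatticePoints`). The part of the sum over one `r`, of height `h` with `I = apexSupport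
r`, is a polynomial in `N = n - h` that vanishes at `-1, …, -(#I - 1)`. Since `h ≤ #I - 1`, it is
already correct for all `n ≥ 0`, including those below `h`. As `#I` is at most the rank `k` of the
vertices, the degree is at most `k - 1 + deg w`.

The bound is attained: `2kN • P` contains `N ^ (k - 1)` lattice points with all coordinates at least
`N`. Finally `k = s - c₀`, because the functions with `y i + y j = 0` on every edge have dimension
`c₀`. The sums of monomials are integers, so the real polynomial has rational coefficients and can
be moved to `K`. -/

/-! ### Lexicographically maximal representations -/

/-- `a` is the lexicographically largest nonnegative coefficient vector representing `∑ i, a i • v i`. -/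
def IsLexMax {E : Type*} [AddCommGroup E] [Module ℝ E] {m : ℕ} (v : Fin m → E) (a : Fin m → ℝ) :
    Prop :=
  0 ≤ a ∧ ∀ b : Fin m → ℝ, 0 ≤ b → ∑ i, b i • v i = ∑ i, a i • v i →
    ¬ Pi.Lex (· < ·) (· < ·) a b

theorem lex_trichotomy {m : ℕ} {a b : Fin m → ℝ} (h : a ≠ b) :
    Pi.Lex (· < ·) (· < ·) a b ∨ Pi.Lex (· < ·) (· < ·) b a := by
  rcases lt_or_gt_of_ne (show toLex a ≠ toLex b from h) with h | h
  · exact Or.inl h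
  · exact Or.inr h

theorem lex_add_smul {m : ℕ} {a b c : Fin m → ℝ} {ε : ℝ} (hε : 0 < ε)
    (h : Pi.Lex (· < ·) (· < ·) a b) : Pi.Lex (· < ·) (· < ·) c (c + ε • (b - a)) := by
  obtain ⟨k, hk, hlt⟩ := h
  refine ⟨k, fun j hj => ?_, ?_⟩
  · simp [hk j hj]
  · have : 0 < ε * (b k - a k) := mul_pos hε (sub_pos.2 hlt)
    simpa using this

/-- Maximise one coordinate after the other: the maximisers of a coordinate on a nonempty compact
set again form a nonempty compact set. -/
theorem exists_lex_max_of_isCompact {m : ℕ} {S : Set (Fin m → ℝ)} (hS : IsCompact S)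
    (hne : S.Nonempty) : ∃ a ∈ S, ∀ b ∈ S, ¬ Pi.Lex (· < ·) (· < ·) a b := by
  have key : ∀ k : ℕ, k ≤ m → ∃ T ⊆ S, IsCompact T ∧ T.Nonempty ∧ ∀ a ∈ T, ∀ b ∈ S,
      (b ∈ T ∧ ∀ j : Fin m, (j : ℕ) < k → b j = a j) ∨
        ∃ i : Fin m, (i : ℕ) < k ∧ (∀ j < i, b j = a j) ∧ b i < a i := by
    intro k
    induction k with
    | zero => exact fun _ => ⟨S, subset_rfl, hS, hne, fun a _ b hb => Or.inl ⟨hb, by simp⟩⟩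
    | succ k ih =>
      intro hk
      obtain ⟨T, hTS, hT, hTne, h⟩ := ih (by omega)
      let K : Fin m := ⟨k, hk⟩
      obtain ⟨c, hcT, hc⟩ := hT.exists_isMaxOn hTne (f := fun a => a K) (by fun_prop)
      have hc' : ∀ b ∈ T, b K ≤ c K := fun b hb => hc hb
      refine ⟨T ∩ {a | a K = c K}, fun a ha => hTS ha.1,
        hT.inter_right (isClosed_eq (by fun_prop) (by fun_prop)), ⟨c, hcT, rfl⟩, ?_⟩
      rintro a ⟨haT, haK⟩ b hb
      rcases h a haT b hb with ⟨hbT, hba⟩ | ⟨i, hi, hij, hlt⟩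
      · by_cases hbK : b K = c K
        · refine Or.inl ⟨⟨hbT, hbK⟩, fun j hj => ?_⟩
          rcases Nat.lt_succ_iff_lt_or_eq.1 hj with hj | hj
          · exact hba j hj
          · have : j = K := Fin.ext hj
            rw [this, hbK]; exact haK.symm
        · refine Or.inr ⟨K, Nat.lt_succ_self k, fun j hj => hba j hj, ?_⟩
          rw [show a K = c K from haK]
          exact lt_of_le_of_ne (hc' b hbT) hbK
      · exact Or.inr ⟨i, by omega, hij, hlt⟩
  obtain ⟨T, hTS, -, ⟨a, ha⟩, h⟩ := key m le_rfl
  refine ⟨a, hTS ha, fun b hb ⟨k, hk, hlt⟩ => ?_⟩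
  rcases h a ha b hb with ⟨-, hba⟩ | ⟨i, -, hij, hlt'⟩
  · exact absurd (hba k k.2) hlt.ne'
  · rcases lt_trichotomy i k with h1 | h1 | h1
    · exact absurd (hk i h1) hlt'.ne'
    · subst h1; exact lt_asymm hlt hlt'
    · exact absurd (hij k h1) hlt.ne'

namespace IsLexMax

variable {E : Type*} [AddCommGroup E] [Module ℝ E] {m : ℕ}

theorem eq_of_sum_eq {v : Fin m → E} {a b : Fin m → ℝ} (ha : IsLexMax v a) (hb : IsLexMax v b)
    (h : ∑ i, a i • v i = ∑ i, b i • v i) : a = b := by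
  by_contra hne
  rcases lex_trichotomy hne with hl | hl
  · exact ha.2 b hb.1 h.symm hl
  · exact hb.2 a ha.1 h hl

/-- An improvement `b` of `a'` would give the improvement `a + ε • (b - a')` of `a`, nonnegative for
small `ε` because `a` is positive wherever `a'` is. Hence maximality depends only on the support,
and the admissible supports are closed under subsets. -/
theorem of_support_subset {v : Fin m → E} {a a' : Fin m → ℝ} (ha : IsLexMax v a) (ha' : 0 ≤ a')
    (hs : ∀ i, a' i ≠ 0 → a i ≠ 0) : IsLexMax v a' := by
  refine ⟨ha', fun b hb hsum hlex => ?_⟩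
  obtain ⟨ε, hε, hle⟩ : ∃ ε : ℝ, 0 < ε ∧ ∀ i, ε * a' i ≤ a i := by
    have : ∀ i, ∀ᶠ ε : ℝ in nhdsWithin 0 (Set.Ioi 0), ε * a' i ≤ a i := by
      intro i
      by_cases h0 : a' i = 0
      · exact Filter.Eventually.of_forall fun ε => by simpa [h0] using ha.1 i
      · have hpos : 0 < a i := lt_of_le_of_ne (ha.1 i) (hs i h0).symm
        have : Filter.Tendsto (fun ε : ℝ => ε * a' i) (nhdsWithin 0 (Set.Ioi 0)) (nhds 0) := by
          have h : Filter.Tendsto (fun ε : ℝ => ε * a' i) (nhds 0) (nhds (0 * a' i)) :=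
            (continuous_id.mul continuous_const).tendsto 0
          rw [zero_mul] at h
          exact h.mono_left nhdsWithin_le_nhds
        exact (this.eventually (gt_mem_nhds hpos)).mono fun _ h => le_of_lt h
    have h2 := (Filter.eventually_all.2 this).and self_mem_nhdsWithin
    obtain ⟨ε, h1, h2⟩ := h2.exists
    exact ⟨ε, h2, h1⟩
  refine ha.2 (a + ε • (b - a')) (fun i => ?_) ?_ (lex_add_smul hε hlex)
  · have h1 := hle i
    have h2 : 0 ≤ ε * b i := mul_nonneg hε.le (hb i)
    simp only [Pi.zero_apply, Pi.add_apply, Pi.smul_apply, Pi.sub_apply, smul_eq_mul, mul_sub]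
    linarith
  · simp only [Pi.add_apply, Pi.smul_apply, Pi.sub_apply, smul_eq_mul, add_smul, mul_smul, sub_smul,
      smul_sub, Finset.sum_add_distrib, Finset.sum_sub_distrib, ← Finset.smul_sum, hsum, sub_self,
      add_zero]

/-- For a linear relation `g` on the support, `|g|` and `|g| + g` are both maximal, by their
supports, and represent the same point. Uniqueness forces `g = 0`. -/
theorem linearIndepOn {v : Fin m → E} {a : Fin m → ℝ} (ha : IsLexMax v a) :
    LinearIndepOn ℝ v {i | a i ≠ 0} := by
  rw [linearIndepOn_iff'']
  intro s g hs hg hsum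
  have hsum' : ∑ i, g i • v i = 0 := by
    rw [← hsum]
    refine (Finset.sum_subset (Finset.subset_univ s) fun i _ hi => ?_).symm
    rw [hg i hi, zero_smul]
  by_contra hne
  push Not at hne
  obtain ⟨i₀, hi₀, hg0⟩ := hne
  have hb : IsLexMax v (fun i => |g i|) := by
    refine ha.of_support_subset (fun i => abs_nonneg _) fun i hi => ?_
    by_contra h0
    exact hi (by simpa using hg i fun his => (hs his) h0)
  have hc : IsLexMax v (fun i => |g i| + g i) := by
    refine hb.of_support_subset (fun i => ?_) fun i hi h0 => hi ?_
    · have := neg_abs_le (g i)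
      simp only [Pi.zero_apply]; linarith
    · have : g i = 0 := by simpa using h0
      simp [this]
  have := hb.eq_of_sum_eq hc (by simp [add_smul, Finset.sum_add_distrib, hsum'])
  have h1 := congrFun this i₀
  simp at h1
  exact hg0 h1

/-- Coordinate 0 is compared first, so a better vector has at least `a 0 + t` there, and `t` can be
subtracted from it again. Geometrically, every simplex can be joined with `v 0`. -/
theorem add_single_zero {v : Fin (m + 1) → E} {a : Fin (m + 1) → ℝ} (ha : IsLexMax v a) {t : ℝ}
    (ht : 0 ≤ t) : IsLexMax v (a + Pi.single 0 t) := by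
  have hs : ∀ c : Fin (m + 1) → ℝ, ∑ i, (c + Pi.single 0 t : Fin (m + 1) → ℝ) i • v i =
      ∑ i, c i • v i + t • v 0 := by
    intro c
    simp only [Pi.add_apply, add_smul, Finset.sum_add_distrib]
    congr 1
    rw [Finset.sum_eq_single 0] <;> simp +contextual
  have hpos : (0 : Fin (m + 1) → ℝ) ≤ Pi.single 0 t := Pi.single_nonneg.2 ht
  refine ⟨add_nonneg ha.1 hpos, fun b hb hsum hlex => ?_⟩
  obtain ⟨k, hk, hlt⟩ := hlex
  have hb0 : a 0 + t ≤ b 0 := by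
    rcases Fin.eq_zero_or_eq_succ k with rfl | ⟨j, rfl⟩
    · simpa using hlt.le
    · simpa using (hk 0 (Fin.succ_pos j)).le
  have hb' : b = (b - Pi.single 0 t) + Pi.single 0 t := by abel
  refine ha.2 (b - Pi.single 0 t) (fun i => ?_) ?_ ⟨k, fun j hj => ?_, ?_⟩
  · by_cases hi : i = 0
    · subst hi
      have := ha.1 0
      simp only [Pi.zero_apply, Pi.sub_apply, Pi.single_eq_same] at *
      linarith
    · simpa [hi] using hb i
  · rw [hb', hs, hs] at hsum
    exact add_right_cancel hsum
  · have := hk j hj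
    simp only [Pi.add_apply, Pi.sub_apply] at *
    linarith
  · simp only [Pi.add_apply, Pi.sub_apply] at *
    linarith

/-- The functional `l` fixes the coefficient sum, so the nonnegative representations of a point form
a compact set. -/
theorem exists_of_nonneg {v : Fin m → E} (l : E →ₗ[ℝ] ℝ) (hl : ∀ i, l (v i) = 1)
    {a : Fin m → ℝ} (ha : 0 ≤ a) : ∃ b, IsLexMax v b ∧ ∑ i, b i • v i = ∑ i, a i • v i := by
  have hsum : ∀ b : Fin m → ℝ, l (∑ i, b i • v i) = ∑ i, b i := fun b => by simp [map_sum, hl]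
  let L : (Fin m → ℝ) →ₗ[ℝ] E := Fintype.linearCombination ℝ v
  have hL : ∀ b, L b = ∑ i, b i • v i := fun b => rfl
  let S : Set (Fin m → ℝ) := Set.Icc 0 (fun _ => ∑ i, a i) ∩ {b | b - a ∈ LinearMap.ker L}
  have hS : IsCompact S := isCompact_Icc.inter_right
    ((Submodule.closed_of_finiteDimensional (LinearMap.ker L)).preimage (by fun_prop))
  have hmem : ∀ b, 0 ≤ b → ∑ i, b i • v i = ∑ i, a i • v i → b ∈ S := by
    intro b hb h
    refine ⟨⟨hb, fun i => ?_⟩, ?_⟩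
    · rw [← hsum, ← h, hsum]
      exact Finset.single_le_sum (fun j _ => hb j) (Finset.mem_univ i)
    · rw [Set.mem_ofPred_eq, LinearMap.mem_ker, map_sub, hL, hL, h, sub_self]
  obtain ⟨b, hb, hmax⟩ := exists_lex_max_of_isCompact hS ⟨a, hmem a ha rfl⟩
  have hba : ∑ i, b i • v i = ∑ i, a i • v i := by
    have := hb.2
    rwa [Set.mem_ofPred_eq, LinearMap.mem_ker, map_sub, hL, hL, sub_eq_zero] at this
  exact ⟨b, ⟨hb.1.1, fun c hc h => hmax c (hmem c hc (h.trans hba))⟩, hba⟩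

end IsLexMax

/-! ### Polynomial sums over dilated standard simplices -/

open Finset in
-- Pascal's rule and a double induction. What matters is that the shift grows from `k` to `k + 1`:
-- each convolution gains one more zero at a negative integer.
theorem sum_antidiagonal_choose_mul_choose {k d : ℕ} (hd : k ≤ d) (e N : ℕ) :
    ∑ p ∈ antidiagonal N, p.1.choose e * (p.2 + k).choose d = (N + k + 1).choose (d + e + 1) := by
  induction e generalizing N with
  | zero =>
    induction N with
    | zero => simp [Nat.choose_succ_succ k d, Nat.choose_eq_zero_of_lt (Nat.lt_succ_of_le hd)]
    | succ N ih =>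
      rw [Nat.sum_antidiagonal_succ]
      simp only [Nat.choose_zero_right, one_mul, add_zero] at ih ⊢
      rw [ih, show N + 1 + k = N + k + 1 by ring, Nat.choose_succ_succ (N + k + 1)]
  | succ e ih =>
    induction N with
    | zero => simp [Nat.choose_eq_zero_of_lt (show k + 1 < d + (e + 1) + 1 by omega)]
    | succ N ihN =>
      rw [Nat.sum_antidiagonal_succ]
      simp only [Nat.choose_zero_succ, zero_mul, zero_add, Nat.choose_succ_succ _ e, add_mul,
        sum_add_distrib]
      rw [ih, ihN, show N + 1 + k + 1 = (N + k + 1) + 1 by ring, Nat.choose_succ_succ]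
      rfl

/-- The span of the functions `N ↦ (N + k).choose d` with `k ≤ d ≤ D`. These are the polynomial
functions of degree at most `D` that vanish at `-1, …, -k`. -/
def binomSpan (k D : ℕ) : Submodule ℝ (ℕ → ℝ) :=
  Submodule.span ℝ {u | ∃ d, k ≤ d ∧ d ≤ D ∧ u = fun N => ((N + k).choose d : ℝ)}

theorem choose_mem_binomSpan {k D d : ℕ} (h₁ : k ≤ d) (h₂ : d ≤ D) :
    (fun N => ((N + k).choose d : ℝ)) ∈ binomSpan k D :=
  Submodule.subset_span ⟨d, h₁, h₂, rfl⟩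

theorem binomSpan_mono {k D D' : ℕ} (h : D ≤ D') : binomSpan k D ≤ binomSpan k D' :=
  Submodule.span_mono fun _ ⟨d, h₁, h₂, hu⟩ => ⟨d, h₁, h₂.trans h, hu⟩

theorem pow_mem_binomSpan (e : ℕ) : (fun N : ℕ => (N : ℝ) ^ e) ∈ binomSpan 0 e := by
  induction e with
  | zero => simpa using choose_mem_binomSpan (k := 0) (D := 0) (d := 0) le_rfl le_rfl
  | succ e ih =>
    have key : ∀ u ∈ binomSpan 0 e, (fun N : ℕ => (N : ℝ) * u N) ∈ binomSpan 0 (e + 1) := by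
      intro u hu
      induction hu using Submodule.span_induction with
      | mem u hu =>
        obtain ⟨d, -, hd, rfl⟩ := hu
        have h : (fun N : ℕ => (N : ℝ) * ((N + 0).choose d : ℝ)) =
            (d + 1 : ℝ) • (fun N : ℕ => ((N + 0).choose (d + 1) : ℝ)) +
              (d : ℝ) • (fun N : ℕ => ((N + 0).choose d : ℝ)) := by
          funext N
          have h1 := Nat.choose_succ_right_eq N d
          simp only [add_zero, Pi.add_apply, Pi.smul_apply, smul_eq_mul]
          rcases le_or_gt d N with hdN | hdN
          · have h2 : (N.choose (d + 1) : ℝ) * (d + 1) = N.choose d * (N - d) := by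
              rw [← Nat.cast_sub hdN]; exact_mod_cast h1
            linarith
          · simp [Nat.choose_eq_zero_of_lt hdN, Nat.choose_eq_zero_of_lt (hdN.trans (Nat.lt_succ_self d))]
        rw [h]
        exact add_mem (Submodule.smul_mem _ _ (choose_mem_binomSpan (by omega) (by omega)))
          (Submodule.smul_mem _ _ (choose_mem_binomSpan (by omega) (by omega)))
      | zero => simp only [Pi.zero_apply, mul_zero]; exact zero_mem _
      | add u w _ _ hu hw => simpa [mul_add] using! add_mem hu hw
      | smul c u _ hu =>
        have := Submodule.smul_mem _ c hu
        convert this using 1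
        funext N
        simp [mul_left_comm]
    simpa [pow_succ'] using key _ ih

/-- The convolution of two functions on `ℕ`. -/
def natConv : (ℕ → ℝ) →ₗ[ℝ] (ℕ → ℝ) →ₗ[ℝ] (ℕ → ℝ) :=
  LinearMap.mk₂ ℝ (fun q u N => ∑ p ∈ Finset.HasAntidiagonal.antidiagonal N, q p.1 * u p.2)
    (fun a b c => by funext N; simp [add_mul, Finset.sum_add_distrib])
    (fun r a b => by funext N; simp [mul_assoc, Finset.mul_sum])
    (fun a b c => by funext N; simp [mul_add, Finset.sum_add_distrib])
    (fun r a b => by funext N; simp [mul_left_comm, Finset.mul_sum])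

theorem natConv_mem_binomSpan {k D E : ℕ} {q u : ℕ → ℝ} (hq : q ∈ binomSpan 0 E)
    (hu : u ∈ binomSpan k D) : natConv q u ∈ binomSpan (k + 1) (D + E + 1) := by
  have h : Submodule.map₂ natConv (binomSpan 0 E) (binomSpan k D) ≤
      binomSpan (k + 1) (D + E + 1) := by
    unfold binomSpan
    rw [Submodule.map₂_span_span, Submodule.span_le]
    rintro _ ⟨_, ⟨e, -, he, rfl⟩, _, ⟨d, hkd, hd, rfl⟩, rfl⟩
    have h : natConv (fun N => ((N + 0).choose e : ℝ)) (fun N => ((N + k).choose d : ℝ)) =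
        fun N => ((N + (k + 1)).choose (d + e + 1) : ℝ) := by
      funext N
      have := sum_antidiagonal_choose_mul_choose hkd e N
      rw [← add_assoc, ← this]
      simp [natConv]
    change natConv _ _ ∈ binomSpan (k + 1) (D + E + 1)
    rw [h]
    exact choose_mem_binomSpan (by omega) (by omega)
  exact h (Submodule.apply_mem_map₂ _ hq hu)

open Finset in
-- Adjoining an index to `I` convolves the sum with a power function, which raises both the number
-- of negative zeros and the degree bound as required.
theorem sum_piAntidiag_prod_pow_mem_binomSpan {ι : Type*} [DecidableEq ι] (β : ι → ℕ)
    {I : Finset ι} (hI : I.Nonempty) :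
    (fun N : ℕ => ∑ m ∈ I.piAntidiag N, ∏ i ∈ I, (m i : ℝ) ^ β i) ∈
      binomSpan (#I - 1) (∑ i ∈ I, β i + (#I - 1)) := by
  induction hI using Finset.Nonempty.cons_induction with
  | singleton a =>
    have h : ∀ N : ℕ, ({a} : Finset ι).piAntidiag N = {Pi.single a N} := by
      intro N
      ext f
      simp only [mem_piAntidiag, sum_singleton, mem_singleton]
      constructor
      · rintro ⟨rfl, hf⟩
        ext i
        by_cases hi : i = a
        · subst hi; simp
        · simpa [hi] using not_imp_comm.1 (hf i) hi
      · rintro rfl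
        refine ⟨by simp, fun i hi => ?_⟩
        by_contra h
        simp [h] at hi
    simpa [h] using pow_mem_binomSpan (β a)
  | cons a s ha hs ih =>
    have hcard : #s - 1 + 1 = #s := Nat.sub_add_cancel hs.card_pos
    have h := natConv_mem_binomSpan (pow_mem_binomSpan (β a)) ih
    rw [card_cons, Nat.add_sub_cancel, sum_cons]
    rw [hcard, show ∑ i ∈ s, β i + (#s - 1) + β a + 1 = β a + ∑ i ∈ s, β i + (#s - 1 + 1) by ring,
      hcard] at h
    convert h using 1
    funext N
    rw [piAntidiag_cons, sum_disjiUnion]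
    simp only [natConv, LinearMap.mk₂_apply]
    refine sum_congr rfl fun p hp => ?_
    rw [sum_map, mul_sum]
    refine sum_congr rfl fun m hm => ?_
    have hma : m a = 0 := by
      by_contra h
      exact ha ((mem_piAntidiag.1 hm).2 a h)
    rw [prod_cons]
    congr 1
    · simp [hma]
    · refine prod_congr rfl fun i hi => ?_
      have : i ≠ a := fun h => ha (h ▸ hi)
      simp [this]

open Finset in
/-- Summing a polynomial over the lattice points of dilated standard simplices. -/
theorem sum_piAntidiag_eval_mem_binomSpan {ι : Type*} [DecidableEq ι] [Fintype ι]
    {I : Finset ι} (hI : I.Nonempty) (g : MvPolynomial ι ℝ) {p : ℕ} (hg : g.totalDegree ≤ p) :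
    (fun N : ℕ => ∑ m ∈ I.piAntidiag N, MvPolynomial.eval (fun i => (m i : ℝ)) g) ∈
      binomSpan (#I - 1) (p + (#I - 1)) := by
  -- Coordinates outside `I` are zero, so they contribute the constants `0 ^ β i`, equal to 1 when
  -- `β i = 0`.
  have h : (fun N : ℕ => ∑ m ∈ I.piAntidiag N, MvPolynomial.eval (fun i => (m i : ℝ)) g) =
      ∑ β ∈ g.support, (g.coeff β * ∏ i ∈ Iᶜ, (0 : ℝ) ^ β i) •
        (fun N : ℕ => ∑ m ∈ I.piAntidiag N, ∏ i ∈ I, (m i : ℝ) ^ β i) := by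
    funext N
    simp only [MvPolynomial.eval_eq', Finset.sum_apply, Pi.smul_apply, smul_eq_mul, mul_sum]
    rw [sum_comm]
    refine sum_congr rfl fun β _ => sum_congr rfl fun m hm => ?_
    rw [← prod_mul_prod_compl I, mul_assoc, mul_comm (∏ i ∈ I, _)]
    congr 2
    refine prod_congr rfl fun i hi => ?_
    have : m i = 0 := by
      by_contra h
      exact mem_compl.1 hi ((mem_piAntidiag.1 hm).2 i h)
    simp [this]
  rw [h]
  refine sum_mem fun β hβ => Submodule.smul_mem _ _ (binomSpan_mono ?_
    (sum_piAntidiag_prod_pow_mem_binomSpan β hI))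
  have h1 : ∑ i, β i ≤ p := by
    have := (MvPolynomial.le_totalDegree hβ).trans hg
    rwa [Finsupp.sum_fintype _ _ fun _ => rfl] at this
  have h2 : ∑ i ∈ I, β i ≤ ∑ i, β i := sum_le_sum_of_subset (subset_univ I)
  omega

open Polynomial in
-- The zeros at `-1, …, -k` cover all `n - h` with `0 ≤ n < h ≤ k`, so cutting the function off
-- below `h` agrees with its polynomial continuation.
theorem exists_polynomial_of_mem_binomSpan {k D h : ℕ} (hk : h ≤ k) {u : ℕ → ℝ}
    (hu : u ∈ binomSpan k D) : ∃ f : ℝ[X], f.natDegree ≤ D ∧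
      ∀ n : ℕ, f.eval (n : ℝ) = if h ≤ n then u (n - h) else 0 := by
  induction hu using Submodule.span_induction with
  | mem u hu =>
    obtain ⟨d, hkd, hd, rfl⟩ := hu
    refine ⟨C ((d.factorial : ℝ)⁻¹) * (descPochhammer ℝ d).comp (X + C ((k - h : ℕ) : ℝ)),
      ?_, fun n => ?_⟩
    · refine (natDegree_C_mul_le _ _).trans ?_
      rw [natDegree_comp, natDegree_X_add_C, mul_one, descPochhammer_natDegree]
      exact hd
    · have h1 := Nat.cast_choose_eq_descPochhammer_div ℝ (n + (k - h)) d
      have h2 : (C ((d.factorial : ℝ)⁻¹) *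
          (descPochhammer ℝ d).comp (X + C ((k - h : ℕ) : ℝ))).eval (n : ℝ) =
            ((n + (k - h)).choose d : ℝ) := by
        rw [h1]
        simp [eval_comp]
        ring
      rw [h2]
      split_ifs with hn
      · congr 2; omega
      · rw [Nat.choose_eq_zero_of_lt (by omega), Nat.cast_zero]
  | zero => exact ⟨0, by simp, by simp⟩
  | add u w _ _ hu hw =>
    obtain ⟨f, hf, hf'⟩ := hu
    obtain ⟨g, hg, hg'⟩ := hw
    refine ⟨f + g, natDegree_add_le_of_degree_le hf hg, fun n => ?_⟩
    rw [eval_add, hf', hg']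
    split_ifs <;> simp
  | smul c u _ hu =>
    obtain ⟨f, hf, hf'⟩ := hu
    refine ⟨C c * f, (natDegree_C_mul_le _ _).trans hf, fun n => ?_⟩
    rw [eval_mul, eval_C, hf']
    split_ifs <;> simp

/-! ### Box points and polynomiality for lattice polytopes -/

theorem mem_smul_convexHull_range {E ι : Type*} [AddCommGroup E] [Module ℝ E] [Fintype ι] [Nonempty ι]
    (v : ι → E) {t : ℝ} (ht : 0 ≤ t) {x : E} :
    x ∈ t • convexHull ℝ (Set.range v) ↔
      ∃ c : ι → ℝ, 0 ≤ c ∧ ∑ i, c i • v i = x ∧ ∑ i, c i = t := by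
  classical
  have hull : ∀ y, y ∈ convexHull ℝ (Set.range v) ↔
      ∃ c : ι → ℝ, 0 ≤ c ∧ ∑ i, c i • v i = y ∧ ∑ i, c i = 1 := by
    intro y
    constructor
    · intro hy
      have hsub : convexHull ℝ (Set.range v) ⊆
          (Fintype.linearCombination ℝ v) '' stdSimplex ℝ ι := by
        refine convexHull_min ?_ ((convex_stdSimplex ℝ ι).linear_image _)
        rintro _ ⟨i, rfl⟩
        exact ⟨Pi.single i 1, single_mem_stdSimplex ℝ i, by simp⟩
      obtain ⟨c, hc, rfl⟩ := hsub hy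
      exact ⟨c, hc.1, rfl, hc.2⟩
    · rintro ⟨c, hc, rfl, h1⟩
      exact mem_convexHull_of_exists_fintype c v hc h1 (fun i => ⟨i, rfl⟩) rfl
  rw [Set.mem_smul_set]
  constructor
  · rintro ⟨y, hy, rfl⟩
    obtain ⟨c, hc, rfl, h1⟩ := (hull y).1 hy
    refine ⟨t • c, smul_nonneg ht hc, ?_, ?_⟩
    · simp [mul_smul, Finset.smul_sum]
    · simp [← Finset.mul_sum, h1]
  · rintro ⟨c, hc, rfl, h1⟩
    -- For `t = 0` the dilate is `{0}` only because the hull is nonempty; any vertex serves as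
    -- witness.
    rcases ht.eq_or_lt with h0 | h0
    · have hc0 : ∀ i, c i = 0 := by
        rw [← h0] at h1
        exact fun i => (Finset.sum_eq_zero_iff_of_nonneg fun i _ => hc i).1 h1 i (Finset.mem_univ i)
      obtain ⟨i⟩ := ‹Nonempty ι›
      exact ⟨v i, subset_convexHull ℝ _ ⟨i, rfl⟩, by simp [hc0, ← h0]⟩
    · refine ⟨∑ i, (t⁻¹ * c i) • v i, (hull _).2 ⟨fun i => t⁻¹ * c i, fun i => ?_, rfl, ?_⟩, ?_⟩
      · exact mul_nonneg (inv_nonneg.2 ht) (hc i)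
      · rw [← Finset.mul_sum, h1, inv_mul_cancel₀ h0.ne']
      · simp [Finset.smul_sum, smul_smul, h0.ne']

/-- The integral part of a nonnegative coefficient vector, rounded so that the fractional part lies
in `[0, 1)` at `0` and in `(0, 1]` at all other indices of the support. -/
noncomputable def natPart {m : ℕ} (a : Fin (m + 1) → ℝ) (i : Fin (m + 1)) : ℕ :=
  if i = 0 then ⌊a i⌋₊ else ⌈a i⌉₊ - 1

/-- Uniqueness of the splitting into integral and fractional part; `natPart_spec` gives existence.
-/
theorem natPart_add {m : ℕ} {r : Fin (m + 1) → ℝ} (hr : 0 ≤ r) (hr1 : ∀ i, r i ≤ 1) (hr0 : r 0 < 1)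
    {μ : Fin (m + 1) → ℕ} (hμ : ∀ i, μ i ≠ 0 → i = 0 ∨ r i ≠ 0) :
    natPart (fun i => r i + μ i) = μ := by
  funext i
  unfold natPart
  split_ifs with hi
  · subst hi
    rw [Nat.floor_add_natCast (hr 0), Nat.floor_eq_zero.2 hr0, zero_add]
  · rw [Nat.ceil_add_natCast (hr i)]
    by_cases h0 : r i = 0
    · have : μ i = 0 := by
        by_contra h
        exact (hμ i h).elim hi fun h => h h0
      simp [h0, this]
    · have h1 : 0 < r i := lt_of_le_of_ne (hr i) (Ne.symm h0)
      have h2 : ⌈r i⌉₊ = 1 := by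
        refine le_antisymm (Nat.ceil_le.2 (by simpa using hr1 i)) (Nat.ceil_pos.2 h1)
      omega

theorem natPart_spec {m : ℕ} {a : Fin (m + 1) → ℝ} (ha : 0 ≤ a) :
    (∀ i, (natPart a i : ℝ) ≤ a i) ∧ (∀ i, a i - natPart a i ≤ 1) ∧ a 0 - natPart a 0 < 1 ∧
      ∀ i, natPart a i ≠ 0 → i = 0 ∨ a i - natPart a i ≠ 0 := by
  have h0 : natPart a 0 = ⌊a 0⌋₊ := by simp [natPart]
  have h0le := Nat.floor_le (ha 0)
  have h0lt := Nat.lt_floor_add_one (a 0)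
  have hpos : ∀ i, i ≠ 0 → a i ≠ 0 →
      (natPart a i : ℝ) < a i ∧ a i - natPart a i ≤ 1 := by
    intro i hi hai
    have hp : 0 < a i := lt_of_le_of_ne (ha i) hai.symm
    have h1 : natPart a i + 1 = ⌈a i⌉₊ := by
      have := Nat.ceil_pos.2 hp
      simp only [natPart, hi, if_false]; omega
    have h2 : (natPart a i : ℝ) + 1 = (⌈a i⌉₊ : ℝ) := by exact_mod_cast h1
    have h3 := Nat.le_ceil (a i)
    have h4 := Nat.ceil_lt_add_one hp.le
    constructor <;> linarith
  have hz : ∀ i, i ≠ 0 → a i = 0 → natPart a i = 0 := by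
    intro i hi hai
    simp [natPart, hi, hai]
  refine ⟨fun i => ?_, fun i => ?_, by rw [h0]; linarith, fun i hμ => ?_⟩ <;>
    by_cases hi : i = 0
  · subst hi; rwa [h0]
  · by_cases hai : a i = 0
    · simp [hz i hi hai, hai]
    · exact (hpos i hi hai).1.le
  · subst hi; rw [h0]; linarith
  · by_cases hai : a i = 0
    · simp [hz i hi hai, hai]
    · exact (hpos i hi hai).2
  · exact Or.inl hi
  · refine Or.inr fun h => ?_
    by_cases hai : a i = 0
    · exact hμ (hz i hi hai)
    · have := (hpos i hi hai).1
      linarith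

theorem totalDegree_bind₁_le {σ τ R : Type*} [Fintype σ] [CommSemiring R]
    (L : σ → MvPolynomial τ R) (hL : ∀ j, (L j).totalDegree ≤ 1) (g : MvPolynomial σ R) :
    (MvPolynomial.bind₁ L g).totalDegree ≤ g.totalDegree := by
  rw [MvPolynomial.bind₁, MvPolynomial.aeval_def, MvPolynomial.eval₂_eq']
  refine MvPolynomial.totalDegree_finsetSum_le fun β hβ => ?_
  refine (MvPolynomial.totalDegree_mul _ _).trans ?_
  rw [MvPolynomial.algebraMap_eq, MvPolynomial.totalDegree_C, zero_add]
  refine (MvPolynomial.totalDegree_finsetProd _ _).trans ?_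
  have h := MvPolynomial.le_totalDegree hβ
  rw [Finsupp.sum_fintype _ _ fun _ => rfl] at h
  refine le_trans (Finset.sum_le_sum fun j _ => ?_) h
  refine (MvPolynomial.totalDegree_pow _ _).trans ?_
  simpa using Nat.mul_le_mul_left (β j) (hL j)

/-- The fundamental parallelepipeds of the pulling triangulation: fractional parts of the
lexicographically maximal coefficient vectors of lattice points of integral height. -/
def boxPoints {V : Type*} {m : ℕ} (v : Fin (m + 1) → V → ℤ) : Set (Fin (m + 1) → ℝ) :=
  {r | IsLexMax (fun i j => (v i j : ℝ)) r ∧ (∀ i, r i ≤ 1) ∧ r 0 < 1 ∧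
    (∃ z : V → ℤ, ∑ i, r i • (fun j => (v i j : ℝ)) = fun j => (z j : ℝ)) ∧
    ∃ h : ℕ, ∑ i, r i = h}

/-- By uniqueness of maximal representations, a box point is determined by the lattice point it
represents, which lies in a dilate of height at most `m + 1`. -/
theorem boxPoints_finite {V : Type*} [Fintype V] {m : ℕ} (v : Fin (m + 1) → V → ℤ) :
    (boxPoints v).Finite := by
  let w : Fin (m + 1) → V → ℝ := fun i j => (v i j : ℝ)
  have hbdd : Bornology.IsBounded (convexHull ℝ (Set.range w)) :=
    isBounded_convexHull.2 (Set.finite_range w).isBounded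
  have hfin : (⋃ h ∈ Finset.range (m + 2), (fun (z : V → ℤ) (j : V) => (z j : ℝ)) ''
      dilateLatticePoints (convexHull ℝ (Set.range w)) h).Finite :=
    Set.Finite.biUnion (Finset.finite_toSet _) fun h _ =>
      (dilateLatticePoints_finite hbdd h).image _
  refine Set.Finite.of_injOn (f := fun r => ∑ i, r i • w i) ?_ ?_ hfin
  · rintro r ⟨hlex, hr1, -, ⟨z, hz⟩, h, hh⟩
    simp only [Set.mem_iUnion]
    refine ⟨h, ?_, z, ?_, hz.symm⟩
    · have : ∑ i, r i ≤ ∑ _i : Fin (m + 1), (1 : ℝ) := Finset.sum_le_sum fun i _ => hr1 i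
      rw [hh] at this
      simp only [Finset.sum_const, Finset.card_univ, Fintype.card_fin, nsmul_eq_mul, mul_one] at this
      have : h ≤ m + 1 := by exact_mod_cast this
      simp; omega
    · exact (mem_smul_convexHull_range w (Nat.cast_nonneg h)).2 ⟨r, hlex.1, hz, hh⟩
  · intro r hr r' hr' h
    exact hr.1.eq_of_sum_eq hr'.1 h

open Classical in
/-- The vertices of the simplex of the triangulation containing `r`, with the apex `0` added. -/
noncomputable def apexSupport {m : ℕ} (r : Fin (m + 1) → ℝ) : Finset (Fin (m + 1)) :=
  {i | i = 0 ∨ r i ≠ 0}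

/-- Adding `v 0` once to `r` gives a maximal vector with support exactly `apexSupport r`, and only
the support matters. -/
theorem IsLexMax.add_of_apexSupport {E : Type*} [AddCommGroup E] [Module ℝ E] {m : ℕ}
    {v : Fin (m + 1) → E} {r μ : Fin (m + 1) → ℝ} (hr : IsLexMax v r) (hμ : 0 ≤ μ)
    (h : ∀ i, μ i ≠ 0 → i ∈ apexSupport r) : IsLexMax v (r + μ) := by
  refine (hr.add_single_zero zero_le_one).of_support_subset (add_nonneg hr.1 hμ) fun i hi => ?_
  by_cases h0 : i = 0
  · subst h0
    have := hr.1 0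
    simp only [Pi.zero_apply, Pi.add_apply, Pi.single_eq_same] at *
    positivity
  · by_cases hri : r i = 0
    · have hμi : μ i ≠ 0 := fun h => hi (by simp [hri, h])
      have := h i hμi
      simp [apexSupport, h0, hri] at this
    · simpa [h0] using hri

theorem IsLexMax.linearIndepOn_apexSupport {E : Type*} [AddCommGroup E] [Module ℝ E] {m : ℕ}
    {v : Fin (m + 1) → E} {r : Fin (m + 1) → ℝ} (hr : IsLexMax v r) :
    LinearIndepOn ℝ v (apexSupport r : Set (Fin (m + 1))) := by
  refine (hr.add_single_zero zero_le_one).linearIndepOn.mono fun i hi => ?_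
  by_cases h0 : i = 0
  · subst h0
    have := hr.1 0
    simp only [Pi.zero_apply, Pi.add_apply, Pi.single_eq_same, Set.mem_ofPred_eq] at *
    positivity
  · simpa [apexSupport, h0] using hi

/-- The strict inequality `r 0 < 1` saves the decisive one: the height stays within the number of
negative zeros of the corresponding simplex sum. -/
theorem boxPoints_sum_lt {V : Type*} {m : ℕ} {v : Fin (m + 1) → V → ℤ} {r : Fin (m + 1) → ℝ}
    (hr : r ∈ boxPoints v) {h : ℕ} (hh : ∑ i, r i = h) : h ≤ (apexSupport r).card - 1 := by
  have h0 : (0 : Fin (m + 1)) ∈ apexSupport r := by simp [apexSupport]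
  have h1 : ∑ i, r i = ∑ i ∈ apexSupport r, r i := by
    refine (Finset.sum_subset (Finset.subset_univ _) fun i _ hi => ?_).symm
    by_contra hri
    exact hi (by simp [apexSupport, hri])
  have h2 : ∑ i ∈ apexSupport r, r i < ∑ i ∈ apexSupport r, (1 : ℝ) :=
    Finset.sum_lt_sum (fun i _ => hr.2.1 i) ⟨0, h0, hr.2.2.1⟩
  rw [← h1, hh] at h2
  have : h < (apexSupport r).card := by
    simp only [Finset.sum_const, nsmul_eq_mul, mul_one] at h2
    exact_mod_cast h2
  omega

open Finset in
/-- The lattice points of `n • P` are the sums of a box point and a natural combination of the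
vertices of its simplex. -/
theorem sum_dilateLatticePoints {V : Type*} [Fintype V] {m : ℕ} (v : Fin (m + 1) → V → ℤ)
    (l : (V → ℝ) →ₗ[ℝ] ℝ) (hl : ∀ i, l (fun j => (v i j : ℝ)) = 1) (φ : (V → ℝ) → ℝ) (n : ℕ) :
    ∑ᶠ a ∈ dilateLatticePoints (convexHull ℝ (Set.range fun i j => (v i j : ℝ))) n,
        φ (fun j => (a j : ℝ)) =
      ∑ r ∈ (boxPoints_finite v).toFinset, if ⌊∑ i, r i⌋₊ ≤ n then
        ∑ μ ∈ (apexSupport r).piAntidiag (n - ⌊∑ i, r i⌋₊),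
          φ (∑ i, (r i + (μ i : ℝ)) • fun j => (v i j : ℝ)) else 0 := by
  classical
  set w : Fin (m + 1) → V → ℝ := fun i j => (v i j : ℝ) with hw
  have hbdd : Bornology.IsBounded (convexHull ℝ (Set.range w)) :=
    isBounded_convexHull.2 (Set.finite_range w).isBounded
  have hlsum : ∀ c : Fin (m + 1) → ℝ, l (∑ i, c i • w i) = ∑ i, c i := fun c => by
    simp [map_sum, hw, hl]
  rw [finsum_mem_eq_finite_toFinset_sum _ (dilateLatticePoints_finite hbdd n)]
  have hite : ∀ r : Fin (m + 1) → ℝ, (if ⌊∑ i, r i⌋₊ ≤ n then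
      ∑ μ ∈ (apexSupport r).piAntidiag (n - ⌊∑ i, r i⌋₊),
        φ (∑ i, (r i + (μ i : ℝ)) • w i) else 0) =
      ∑ μ ∈ if ⌊∑ i, r i⌋₊ ≤ n then (apexSupport r).piAntidiag (n - ⌊∑ i, r i⌋₊) else ∅,
        φ (∑ i, (r i + (μ i : ℝ)) • w i) := by
    intro r
    split_ifs <;> simp
  refine Eq.trans ?_ (sum_congr rfl fun r _ => (hite r).symm)
  rw [sum_sigma']
  have hmem : ∀ p : (Σ _ : Fin (m + 1) → ℝ, Fin (m + 1) → ℕ),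
      p ∈ (boxPoints_finite v).toFinset.sigma (fun r => if ⌊∑ i, r i⌋₊ ≤ n then
        (apexSupport r).piAntidiag (n - ⌊∑ i, r i⌋₊) else ∅) ↔
      p.1 ∈ boxPoints v ∧ ∑ i, (p.1 i + (p.2 i : ℝ)) = n ∧ ∀ i, p.2 i ≠ 0 → i ∈ apexSupport p.1 := by
    rintro ⟨r, μ⟩
    simp only [mem_sigma, Set.Finite.mem_toFinset]
    refine and_congr_right fun hr => ?_
    obtain ⟨h, hh⟩ := hr.2.2.2.2
    rw [hh, Nat.floor_natCast, sum_add_distrib, hh]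
    have hsub : (∀ i, μ i ≠ 0 → i ∈ apexSupport r) → ∑ i, μ i = ∑ i ∈ apexSupport r, μ i := by
      intro hμ
      exact (sum_subset (subset_univ _) fun i _ hi => by
        by_contra hne; exact hi (hμ i hne)).symm
    split_ifs with hn
    · rw [mem_piAntidiag]
      refine and_congr_left fun hμ => ?_
      rw [← hsub hμ]
      have : ((h : ℝ) + ∑ i, (μ i : ℝ) = n) ↔ h + ∑ i, μ i = n := by exact_mod_cast Iff.rfl
      rw [this]
      omega
    · simp only [notMem_empty, false_iff, not_and]
      intro h1
      have : h + ∑ i, μ i = n := by exact_mod_cast h1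
      omega
  have hint : ∀ r ∈ boxPoints v, ∀ μ : Fin (m + 1) → ℕ, ∃ a : V → ℤ,
      ∑ i, (r i + (μ i : ℝ)) • w i = fun j => (a j : ℝ) := by
    rintro r ⟨-, -, -, ⟨z, hz⟩, -⟩ μ
    refine ⟨fun j => z j + ∑ i, μ i * v i j, ?_⟩
    simp only [add_smul, sum_add_distrib]
    rw [hz]
    funext j
    simp [hw, Finset.sum_apply]
  have hlex : ∀ r ∈ boxPoints v, ∀ μ : Fin (m + 1) → ℕ, (∀ i, μ i ≠ 0 → i ∈ apexSupport r) →
      IsLexMax w (fun i => r i + (μ i : ℝ)) := fun r hr μ hμ =>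
    hr.1.add_of_apexSupport (μ := fun i => (μ i : ℝ)) (fun i => Nat.cast_nonneg _)
      fun i hi => hμ i fun h => hi (by simp [h])
  symm
  -- The coordinates are already integers by `hint`; the floor only turns them into elements of `ℤ`.
  refine sum_bij (fun p _ => fun j => ⌊(∑ i, (p.1 i + (p.2 i : ℝ)) • w i) j⌋) ?_ ?_ ?_ ?_
  · rintro ⟨r, μ⟩ hp
    obtain ⟨hr, hsum, hμ⟩ := (hmem _).1 hp
    obtain ⟨a, ha⟩ := hint r hr μ
    rw [Set.Finite.mem_toFinset]
    refine (mem_smul_convexHull_range w (Nat.cast_nonneg n)).2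
      ⟨_, (hlex r hr μ hμ).1, ?_, hsum⟩
    rw [ha]
    simp
  · rintro ⟨r, μ⟩ hp ⟨r', μ'⟩ hp' h
    obtain ⟨hr, hsum, hμ⟩ := (hmem _).1 hp
    obtain ⟨hr', hsum', hμ'⟩ := (hmem _).1 hp'
    obtain ⟨a, ha⟩ := hint r hr μ
    obtain ⟨a', ha'⟩ := hint r' hr' μ'
    simp only [] at hsum hμ hsum' hμ'
    have haa : a = a' := by
      simpa only [ha, ha', Int.floor_intCast] using h
    have heq := (hlex r hr μ hμ).eq_of_sum_eq (hlex r' hr' μ' hμ') (by rw [ha, ha', haa])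
    have h1 := natPart_add hr.1.1 hr.2.1 hr.2.2.1 (μ := μ)
      fun i hi => by simpa [apexSupport] using hμ i hi
    have h2 := natPart_add hr'.1.1 hr'.2.1 hr'.2.2.1 (μ := μ')
      fun i hi => by simpa [apexSupport] using hμ' i hi
    have hμμ : μ = μ' := by rw [← h1, ← h2, heq]
    subst hμμ
    have hrr : r = r' := by
      funext i
      simpa using congrFun heq i
    rw [hrr]
  · intro a ha
    rw [Set.Finite.mem_toFinset] at ha
    obtain ⟨c, hc, hca, hcn⟩ := (mem_smul_convexHull_range w (Nat.cast_nonneg n)).1 ha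
    obtain ⟨b, hb, hbc⟩ := IsLexMax.exists_of_nonneg l hl hc
    have hba : ∑ i, b i • w i = fun j => (a j : ℝ) := hbc.trans hca
    have hbn : ∑ i, b i = n := by rw [← hlsum, hbc, hlsum, hcn]
    obtain ⟨h1, h2, h3, h4⟩ := natPart_spec hb.1
    have hr0 : 0 ≤ fun i => b i - (natPart b i : ℝ) := fun i => sub_nonneg.2 (h1 i)
    have hcancel : ∀ i, b i - (natPart b i : ℝ) + natPart b i = b i := fun i => by ring
    have hbox : (fun i => b i - (natPart b i : ℝ)) ∈ boxPoints v := by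
      refine ⟨hb.of_support_subset hr0 fun i hi hbi => hi ?_, h2, h3,
        ⟨fun j => a j - ∑ i, natPart b i * v i j, ?_⟩, ?_⟩
      · have := h1 i
        have h0 : (0 : ℝ) ≤ natPart b i := Nat.cast_nonneg _
        linarith
      · simp only [sub_smul, sum_sub_distrib]
        rw [hba]
        funext j
        simp [Finset.sum_apply]
      · have hle : ∑ i, natPart b i ≤ n := by
          have : ∑ i, (natPart b i : ℝ) ≤ n := hbn ▸ sum_le_sum fun i _ => h1 i
          exact_mod_cast this
        refine ⟨n - ∑ i, natPart b i, ?_⟩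
        rw [sum_sub_distrib, hbn, Nat.cast_sub hle, Nat.cast_sum]
    refine ⟨⟨fun i => b i - (natPart b i : ℝ), natPart b⟩, (hmem _).2 ⟨hbox, ?_, ?_⟩, ?_⟩
    · simp only [hcancel, hbn]
    · intro i hi
      simpa [apexSupport] using h4 i hi
    · simp only [hcancel, hba, Int.floor_intCast]
  · rintro ⟨r, μ⟩ hp
    obtain ⟨hr, hsum, hμ⟩ := (hmem _).1 hp
    obtain ⟨a, ha⟩ := hint r hr μ
    simp only [ha, Int.floor_intCast]

open Polynomial in
/-- Weighted Ehrhart functions of lattice polytopes (at height one) are polynomial, with the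
expected bound on the degree. -/
theorem exists_polynomial_sum_dilateLatticePoints {V : Type*} [Fintype V] {m : ℕ}
    (v : Fin (m + 1) → V → ℤ) (l : (V → ℝ) →ₗ[ℝ] ℝ) (hl : ∀ i, l (fun j => (v i j : ℝ)) = 1)
    (g : MvPolynomial V ℝ) :
    ∃ f : ℝ[X], f.natDegree ≤ g.totalDegree +
        (Module.finrank ℝ (Submodule.span ℝ (Set.range fun i j => (v i j : ℝ))) - 1) ∧
      ∀ n : ℕ, ∑ᶠ a ∈ dilateLatticePoints (convexHull ℝ (Set.range fun i j => (v i j : ℝ))) n,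
        MvPolynomial.eval (fun j => (a j : ℝ)) g = f.eval (n : ℝ) := by
  classical
  have key : ∀ r ∈ (boxPoints_finite v).toFinset, ∃ f : ℝ[X], f.natDegree ≤ g.totalDegree +
        (Module.finrank ℝ (Submodule.span ℝ (Set.range fun i j => (v i j : ℝ))) - 1) ∧
      ∀ n : ℕ, f.eval (n : ℝ) = if ⌊∑ i, r i⌋₊ ≤ n then
        ∑ μ ∈ (apexSupport r).piAntidiag (n - ⌊∑ i, r i⌋₊),
          MvPolynomial.eval (∑ i, (r i + (μ i : ℝ)) • fun j => (v i j : ℝ)) g else 0 := by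
    intro r hr
    rw [Set.Finite.mem_toFinset] at hr
    obtain ⟨h, hh⟩ := hr.2.2.2.2
    have hle := boxPoints_sum_lt hr hh
    have hI : (apexSupport r).Nonempty := ⟨0, by simp [apexSupport]⟩
    have hcard : (apexSupport r).card ≤
        Module.finrank ℝ (Submodule.span ℝ (Set.range fun i j => (v i j : ℝ))) := by
      have h1 := hr.1.linearIndepOn_apexSupport
      have h2 := finrank_span_eq_card h1.linearIndependent
      simp only [SetLike.coe_sort_coe, Fintype.card_coe] at h2
      rw [← h2]
      refine Submodule.finrank_mono (Submodule.span_mono ?_)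
      rintro _ ⟨i, rfl⟩
      exact ⟨i, rfl⟩
    -- The coordinates of the lattice point are affine linear in `μ`; substituting them into `g`
    -- does not raise its degree.
    let L : V → MvPolynomial (Fin (m + 1)) ℝ := fun j =>
      ∑ i, (MvPolynomial.C (r i) + MvPolynomial.X i) * MvPolynomial.C (v i j : ℝ)
    have hL : ∀ j, (L j).totalDegree ≤ 1 := by
      intro j
      refine MvPolynomial.totalDegree_finsetSum_le fun i _ => ?_
      refine (MvPolynomial.totalDegree_mul _ _).trans ?_
      rw [MvPolynomial.totalDegree_C, add_zero]
      refine (MvPolynomial.totalDegree_add _ _).trans ?_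
      simp
    obtain ⟨f, hf, hfe⟩ := exists_polynomial_of_mem_binomSpan hle
      (sum_piAntidiag_eval_mem_binomSpan hI (MvPolynomial.bind₁ L g) (totalDegree_bind₁_le L hL g))
    refine ⟨f, by omega, fun n => ?_⟩
    rw [hfe, hh, Nat.floor_natCast]
    refine if_congr Iff.rfl (Finset.sum_congr rfl fun μ _ => ?_) rfl
    unfold MvPolynomial.eval
    rw [MvPolynomial.eval₂Hom_bind₁]
    congr 2
    funext j
    simp [L, Finset.sum_apply]
  choose! f hf hfe using key
  refine ⟨∑ r ∈ (boxPoints_finite v).toFinset, f r, natDegree_sum_le_of_forall_le _ _ hf, fun n => ?_⟩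
  rw [sum_dilateLatticePoints v l hl (fun x => MvPolynomial.eval x g) n, eval_finsetSum]
  exact Finset.sum_congr rfl fun r hr => (hfe r hr n).symm

/-! ### Rank of the unsigned incidence matrix -/

namespace SimpleGraph

variable {V : Type*} (G : SimpleGraph V)

theorem eq_of_connectedComponentMk_eq {G : SimpleGraph V} {α : Type*} {f : V → α}
    (hf : ∀ i j, G.Adj i j → f i = f j) {i j : V}
    (h : G.connectedComponentMk i = G.connectedComponentMk j) : f i = f j := by
  obtain ⟨p⟩ := ConnectedComponent.exact h
  induction p with
  | nil => rfl
  | cons hadj p ih => exact (hf _ _ hadj).trans (ih (ConnectedComponent.sound p.reachable))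

/-- A function that is a proper `±1`-colouring on the bipartite components and `0` elsewhere. -/
theorem exists_bipartite_sign : ∃ σ : V → ℝ, (∀ i j, G.Adj i j → σ i + σ j = 0) ∧
    ∀ v, ((G.connectedComponentMk v).toSimpleGraph.IsBipartite → σ v * σ v = 1) ∧
      (¬ (G.connectedComponentMk v).toSimpleGraph.IsBipartite → σ v = 0) := by
  classical
  have hcol : ∀ C : G.ConnectedComponent, ∃ s : V → ℝ, (∀ i ∈ C, ∀ j ∈ C, G.Adj i j → s i + s j = 0) ∧
      (C.toSimpleGraph.IsBipartite → ∀ v ∈ C, s v * s v = 1) ∧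
      (¬ C.toSimpleGraph.IsBipartite → ∀ v ∈ C, s v = 0) := by
    intro C
    by_cases hC : C.toSimpleGraph.IsBipartite
    · obtain ⟨c⟩ := id hC
      refine ⟨fun v => if h : v ∈ C then (if c ⟨v, h⟩ = 0 then 1 else -1) else 0, ?_, ?_, fun h => absurd hC h⟩
      · intro i hi j hj hij
        have := c.valid ((C.toSimpleGraph_adj hi hj).2 hij)
        simp only [hi, hj, dif_pos]
        split_ifs with h1 h2 h2
        · exact absurd (h1.trans h2.symm) this
        · norm_num
        · norm_num
        · exact absurd (by omega) this
      · intro _ v hv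
        simp only [hv, dif_pos]
        split_ifs <;> norm_num
    · exact ⟨0, by simp, fun h => absurd h hC, by simp⟩
  choose s hs hs1 hs0 using hcol
  refine ⟨fun v => s (G.connectedComponentMk v) v, fun i j hij => ?_, fun v =>
    ⟨fun h => hs1 _ h v rfl, fun h => hs0 _ h v rfl⟩⟩
  have h : G.connectedComponentMk j = G.connectedComponentMk i :=
    ConnectedComponent.sound hij.symm.reachable
  simp only [h]
  exact hs _ i rfl j h hij

/-- The kernel of the transposed unsigned incidence matrix. -/
def antisymmetricFunctions : Submodule ℝ (V → ℝ) where
  carrier := {y | ∀ i j, G.Adj i j → y i + y j = 0}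
  zero_mem' := by simp
  add_mem' {y z} hy hz i j h := by
    have h1 := hy i j h
    have h2 := hz i j h
    simp only [Pi.add_apply]
    linarith
  smul_mem' c y hy i j h := by
    simp only [Pi.smul_apply, smul_eq_mul, ← mul_add, hy i j h, mul_zero]

/-- Along edges `y` changes sign and `y ^ 2` is constant. If `y v ≠ 0`, the sign of `y` is therefore
a 2-colouring of the component. -/
theorem eq_zero_of_mem_antisymmetricFunctions {G : SimpleGraph V} {y : V → ℝ}
    (hy : y ∈ G.antisymmetricFunctions) {v : V}
    (hv : ¬ (G.connectedComponentMk v).toSimpleGraph.IsBipartite) : y v = 0 := by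
  by_contra h0
  refine hv ⟨Coloring.mk (fun u => if 0 < y u then (0 : Fin 2) else 1) ?_⟩
  rintro ⟨i, hi⟩ ⟨j, hj⟩ hij
  have hadj := ((G.connectedComponentMk v).toSimpleGraph_adj hi hj).1 hij
  have hne : y i * y i = y v * y v :=
    eq_of_connectedComponentMk_eq (f := fun i => y i * y i) (fun i j h => by
      have := hy i j h
      have : y i = - y j := by linarith
      simp [this]) hi
  have hyi : y i ≠ 0 := fun h => h0 (by simpa [h] using hne.symm)
  have := hy i j hadj
  rcases lt_or_gt_of_ne hyi with h | h
  · have h' : 0 < y j := by linarith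
    simp [h', h.not_gt]
  · have h' : ¬ 0 < y j := by linarith
    simp [h', h]

/-- The product of `y` with the sign function `σ` is constant on components, so `y` amounts to one
free real number for each bipartite component. -/
theorem finrank_antisymmetricFunctions [Finite V] :
    Module.finrank ℝ G.antisymmetricFunctions = numBipartiteComponents G := by
  classical
  have := Fintype.ofFinite V
  obtain ⟨σ, hσ, hσv⟩ := G.exists_bipartite_sign
  let B := {C : G.ConnectedComponent // C.toSimpleGraph.IsBipartite}
  have hfin : Finite G.ConnectedComponent := Quot.finite _
  have := Fintype.ofFinite B
  let rep : G.ConnectedComponent → V := Quot.out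
  have hrep : ∀ C, G.connectedComponentMk (rep C) = C := fun C => Quot.out_eq C
  let Φ : G.antisymmetricFunctions →ₗ[ℝ] (B → ℝ) :=
    { toFun := fun y C => y.1 (rep C.1) * σ (rep C.1)
      map_add' := fun y z => by funext C; simp [add_mul]
      map_smul' := fun c y => by funext C; simp [mul_assoc] }
  have hinj : Function.Injective Φ := by
    rw [injective_iff_map_eq_zero]
    rintro ⟨y, hy⟩ h
    ext v
    by_cases hv : (G.connectedComponentMk v).toSimpleGraph.IsBipartite
    · have h1 : y (rep (G.connectedComponentMk v)) * σ (rep (G.connectedComponentMk v)) = 0 :=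
        congrFun h ⟨_, hv⟩
      have h2 : y v * σ v = 0 := by
        rw [← h1]
        refine eq_of_connectedComponentMk_eq (f := fun i => y i * σ i) (fun i j h => ?_)
          (hrep _).symm
        have e1 : y i = - y j := by linarith [hy i j h]
        have e2 : σ i = - σ j := by linarith [hσ i j h]
        simp [e1, e2]
      have h3 : σ v ≠ 0 := fun h0 => by simpa [h0] using (hσv v).1 hv
      exact (mul_eq_zero.1 h2).resolve_right h3
    · exact eq_zero_of_mem_antisymmetricFunctions hy hv
  have hsurj : Function.Surjective Φ := by
    intro c
    let d : G.ConnectedComponent → ℝ := fun C =>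
      if h : C.toSimpleGraph.IsBipartite then c ⟨C, h⟩ else 0
    refine ⟨⟨fun v => d (G.connectedComponentMk v) * σ v, fun i j hij => ?_⟩, ?_⟩
    · have h : G.connectedComponentMk j = G.connectedComponentMk i :=
        ConnectedComponent.sound hij.symm.reachable
      simp only [h, ← mul_add, hσ i j hij, mul_zero]
    · funext ⟨C, hC⟩
      have h1 := hC
      rw [← hrep C] at h1
      have h2 := (hσv (rep C)).1 h1
      have h3 : d C = c ⟨C, hC⟩ := dif_pos hC
      simp only [Φ, LinearMap.coe_mk, AddHom.coe_mk, mul_assoc, h2, hrep, mul_one, h3]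
  rw [(LinearEquiv.ofBijective Φ ⟨hinj, hsurj⟩).finrank_eq, Module.finrank_fintype_fun_eq_card,
    numBipartiteComponents, Nat.card_eq_fintype_card]

/-- The rank of the unsigned incidence matrix of a graph. -/
theorem finrank_span_edge_add_numBipartiteComponents [Fintype V] [DecidableEq V] :
    Module.finrank ℝ (Submodule.span ℝ (Set.range fun p : {p : V × V // G.Adj p.1 p.2} =>
      (Pi.single p.1.1 1 + Pi.single p.1.2 1 : V → ℝ))) + numBipartiteComponents G =
      Fintype.card V := by
  classical
  let A : Matrix {p : V × V // G.Adj p.1 p.2} V ℝ :=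
    Matrix.of fun p => Pi.single p.1.1 1 + Pi.single p.1.2 1
  have hA : ∀ y p, A.mulVecLin y p = y p.1.1 + y p.1.2 := by
    intro y p
    change (Pi.single p.1.1 1 + Pi.single p.1.2 1) ⬝ᵥ y = _
    rw [add_dotProduct, single_dotProduct, single_dotProduct, one_mul, one_mul]
  have hker : LinearMap.ker A.mulVecLin = G.antisymmetricFunctions := by
    ext y
    rw [LinearMap.mem_ker]
    constructor
    · intro h i j hij
      have := congrFun h ⟨(i, j), hij⟩
      rwa [hA] at this
    · intro h
      funext p
      rw [hA]
      exact h _ _ p.2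
  have h1 := LinearMap.finrank_range_add_finrank_ker A.mulVecLin
  rw [hker, finrank_antisymmetricFunctions, Module.finrank_fintype_fun_eq_card] at h1
  rw [← h1]
  congr 1
  exact A.rank_eq_finrank_span_row.symm

end SimpleGraph

/-! ### Lower bound for the growth -/

open Finset in
/-- A lower bound for monomial sums over the lattice points of a polytope spanned by nonnegative
lattice points. -/
theorem pow_le_sum_dilateLatticePoints {V ι : Type*} [Fintype V] [Fintype ι] [Nonempty ι]
    (v : ι → V → ℤ) (hv : ∀ i j, 0 ≤ v i j) (hcov : ∀ j, ∃ i, v i j ≠ 0) (hne : ∃ i, v i ≠ 0)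
    (b : V → ℕ) {k : ℕ}
    (hk : k = Module.finrank ℝ (Submodule.span ℝ (Set.range fun i j => (v i j : ℝ)))) (N : ℕ) :
    (N : ℤ) ^ (k - 1 + ∑ j, b j) ≤
      ∑ᶠ a ∈ dilateLatticePoints (convexHull ℝ (Set.range fun i j => (v i j : ℝ))) (2 * k * N),
        ∏ j, a j ^ b j := by
  classical
  set w : ι → V → ℝ := fun i j => (v i j : ℝ) with hw
  have hbdd : Bornology.IsBounded (convexHull ℝ (Set.range w)) :=
    isBounded_convexHull.2 (Set.finite_range w).isBounded
  obtain ⟨κ, e, he, hspan, hind⟩ := exists_linearIndependent' ℝ w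
  have : Finite κ := Finite.of_injective e he
  have := Fintype.ofFinite κ
  have hcard : Fintype.card κ = k := by
    rw [hk, ← hspan, finrank_span_eq_card hind]
  -- A coordinate vanishing on the chosen basis would vanish on the whole span, hence on all `v i`.
  have hcov' : ∀ j, ∃ i, 1 ≤ v (e i) j := by
    intro j
    by_contra! hcon
    have h0 : ∀ i, w (e i) j = 0 := fun i => by
      have h1 := hcon i
      have h2 := hv (e i) j
      simp only [hw]
      exact_mod_cast (by omega : v (e i) j = 0)
    have hle : Submodule.span ℝ (Set.range w) ≤ LinearMap.ker (LinearMap.proj (R := ℝ) (φ := fun _ => ℝ) j) := by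
      rw [← hspan, Submodule.span_le]
      rintro _ ⟨i, rfl⟩
      exact h0 i
    obtain ⟨i, hi⟩ := hcov j
    have : w i j = 0 := hle (Submodule.subset_span ⟨i, rfl⟩)
    exact hi (by simpa [hw] using this)
  obtain ⟨i₀, hi₀⟩ := hne
  obtain ⟨j₀, hj₀⟩ : ∃ j, v i₀ j ≠ 0 := by
    by_contra! h
    exact hi₀ (funext h)
  obtain ⟨i₁, -⟩ := hcov' j₀
  -- One index `i₁` is reserved to adjust the height, leaving `k - 1` free parameters with `N`
  -- values each.
  let T : Finset (κ → ℕ) := Fintype.piFinset fun i => if i = i₁ then {0} else range N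
  have hTcard : #T = N ^ (k - 1) := by
    rw [Fintype.card_piFinset, ← mul_prod_erase univ _ (mem_univ i₁)]
    rw [prod_congr rfl (g := fun _ => N) fun i hi => by simp [(mem_erase.1 hi).1]]
    simp [hcard]
  have hT : ∀ t ∈ T, t i₁ = 0 ∧ ∑ i, (N + t i) ≤ 2 * k * N := by
    intro t ht
    have h := Fintype.mem_piFinset.1 ht
    refine ⟨by simpa using h i₁, ?_⟩
    have : ∑ i, (N + t i) ≤ ∑ _i : κ, 2 * N := sum_le_sum fun i _ => by
      have := h i
      split_ifs at this
      · simp at this; omega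
      · simp at this; omega
    refine this.trans (le_of_eq ?_)
    simp [hcard]; ring
  -- Before correction each coefficient lies between `N` and `2 * N`, so the total is at most `2 * k
  -- * N`; the slack goes to `i₁`.
  let c : (κ → ℕ) → κ → ℕ := fun t i =>
    N + t i + if i = i₁ then 2 * k * N - ∑ i, (N + t i) else 0
  have hcN : ∀ t i, N ≤ c t i := fun t i => by simp only [c]; omega
  have hcsum : ∀ t ∈ T, ∑ i, c t i = 2 * k * N := by
    intro t ht
    have := (hT t ht).2
    simp only [c]
    rw [sum_add_distrib, sum_ite_eq' univ i₁]
    simp only [mem_univ, if_true]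
    omega
  have hcinj : ∀ t ∈ T, ∀ t' ∈ T, c t = c t' → t = t' := by
    intro t ht t' ht' h
    funext i
    by_cases hi : i = i₁
    · rw [hi, (hT t ht).1, (hT t' ht').1]
    · simpa [c, hi] using congrFun h i
  let x : (κ → ℕ) → V → ℤ := fun t j => ∑ i, c t i * v (e i) j
  have hx : ∀ t, (fun j => (x t j : ℝ)) = ∑ i, (c t i : ℝ) • w (e i) := by
    intro t
    funext j
    simp [x, hw, Finset.sum_apply]
  have hxN : ∀ t j, (N : ℤ) ≤ x t j := by
    intro t j
    obtain ⟨i, hi⟩ := hcov' j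
    have h1 : (N : ℤ) ≤ c t i * v (e i) j := by
      have : (N : ℤ) ≤ c t i := by exact_mod_cast hcN t i
      nlinarith
    exact h1.trans (single_le_sum (f := fun i => (c t i : ℤ) * v (e i) j)
      (fun i _ => mul_nonneg (Int.natCast_nonneg _) (hv _ _)) (mem_univ i))
  have hxinj : Set.InjOn x T := by
    intro t ht t' ht' h
    refine hcinj t ht t' ht' ?_
    have h1 : ∑ i, ((c t i : ℝ) - c t' i) • w (e i) = 0 := by
      simp only [sub_smul, sum_sub_distrib]
      rw [← hx, ← hx, h, sub_self]
    have h2 := Fintype.linearIndependent_iff.1 hind _ h1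
    funext i
    exact_mod_cast sub_eq_zero.1 (h2 i)
  have : Nonempty κ := ⟨i₁⟩
  have hxmem : ∀ t ∈ T, x t ∈ dilateLatticePoints (convexHull ℝ (Set.range w)) (2 * k * N) := by
    intro t ht
    have h1 : (fun j => (x t j : ℝ)) ∈
        ((2 * k * N : ℕ) : ℝ) • convexHull ℝ (Set.range (w ∘ e)) :=
      (mem_smul_convexHull_range (w ∘ e) (Nat.cast_nonneg _)).2
        ⟨fun i => (c t i : ℝ), fun i => Nat.cast_nonneg _, (hx t).symm,
          by rw [← hcsum t ht, Nat.cast_sum]⟩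
    exact Set.smul_set_mono (convexHull_mono (Set.range_comp_subset_range e w)) h1
  rw [finsum_mem_eq_finite_toFinset_sum _ (dilateLatticePoints_finite hbdd _)]
  have hnonneg : ∀ a ∈ (dilateLatticePoints_finite hbdd (2 * k * N)).toFinset,
      0 ≤ ∏ j, a j ^ b j := by
    intro a ha
    rw [Set.Finite.mem_toFinset] at ha
    obtain ⟨d, hd, hda, -⟩ := (mem_smul_convexHull_range w (Nat.cast_nonneg _)).1 ha
    refine prod_nonneg fun j _ => pow_nonneg ?_ _
    have : (0 : ℝ) ≤ (a j : ℝ) := by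
      have h := congrFun hda j
      rw [← h, Finset.sum_apply]
      exact sum_nonneg fun i _ => mul_nonneg (hd i) (by simp only [hw]; exact_mod_cast hv i j)
    exact_mod_cast this
  calc (N : ℤ) ^ (k - 1 + ∑ j, b j) = ∑ _a ∈ T.image x, (N : ℤ) ^ (∑ j, b j) := by
        rw [sum_const, card_image_of_injOn hxinj, hTcard, pow_add]
        simp
    _ ≤ ∑ a ∈ T.image x, ∏ j, a j ^ b j := by
        refine sum_le_sum fun a ha => ?_
        obtain ⟨t, -, rfl⟩ := mem_image.1 ha
        rw [← prod_pow_eq_pow_sum]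
        exact prod_le_prod (fun j _ => by positivity)
          fun j _ => pow_le_pow_left₀ (by positivity) (hxN t j) _
    _ ≤ _ := by
        refine sum_le_sum_of_subset_of_nonneg ?_ fun a ha _ => hnonneg a ha
        intro a ha
        obtain ⟨t, ht, rfl⟩ := mem_image.1 ha
        rw [Set.Finite.mem_toFinset]
        exact hxmem t ht

/-! ### Rational coefficients and exact degree -/

open Polynomial in
-- Interpolation over `ℚ` at `f.natDegree + 1` natural numbers yields a polynomial that must
-- coincide with `f` over `ℝ`.
theorem exists_rat_polynomial_map_eq {u : ℕ → ℤ} {f : ℝ[X]} (hf : ∀ n : ℕ, (u n : ℝ) = f.eval (n : ℝ)) :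
    ∃ g : ℚ[X], (∀ n : ℕ, (u n : ℚ) = g.eval (n : ℚ)) ∧ g.map (algebraMap ℚ ℝ) = f := by
  let s := Finset.range (f.natDegree + 1)
  have hinj : Set.InjOn (fun n : ℕ => (n : ℚ)) s := fun a _ b _ h => Nat.cast_injective h
  let g := Lagrange.interpolate s (fun n : ℕ => (n : ℚ)) (fun n => (u n : ℚ))
  have hmap : g.map (algebraMap ℚ ℝ) = f := by
    refine Polynomial.eq_of_degrees_lt_of_eval_index_eq (v := fun n : ℕ => (n : ℝ)) s
      (fun a _ b _ h => Nat.cast_injective h) ?_ ?_ fun n hn => ?_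
    · rw [degree_map]
      exact Lagrange.degree_interpolate_lt _ hinj
    · refine degree_le_natDegree.trans_lt ?_
      simp only [s, Finset.card_range]
      exact_mod_cast Nat.lt_succ_self _
    · have h1 : g.eval (n : ℚ) = u n := Lagrange.eval_interpolate_at_node _ hinj hn
      rw [← hf, ← map_natCast (algebraMap ℚ ℝ), eval_map_algebraMap, aeval_algebraMap_apply, coe_aeval_eq_eval, h1]
      simp
  refine ⟨g, fun n => ?_, hmap⟩
  have h := hf n
  rw [← hmap, ← map_natCast (algebraMap ℚ ℝ), eval_map_algebraMap, aeval_algebraMap_apply, coe_aeval_eq_eval] at h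
  simp only [eq_ratCast] at h
  exact_mod_cast h

open Polynomial in
-- With a smaller degree, `f (q * N) / N ^ D` would tend to 0, although it is at least 1 for `N >
-- 0`.
theorem degree_eq_of_pow_le {f : ℝ[X]} {D q : ℕ} (hf : f.natDegree ≤ D)
    (h : ∀ N : ℕ, (N : ℝ) ^ D ≤ f.eval ((q * N : ℕ) : ℝ)) : f.degree = D := by
  refine le_antisymm (natDegree_le_iff_degree_le.1 hf) ?_
  by_contra! hlt
  let F : ℝ[X] := f.comp (C (q : ℝ) * X)
  have hF : F.degree < (X ^ D : ℝ[X]).degree := by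
    rw [degree_X_pow]
    refine lt_of_le_of_lt ?_ hlt
    by_cases hf0 : f = 0
    · simp [F, hf0]
    · rw [degree_eq_natDegree hf0, ← natDegree_le_iff_degree_le]
      refine natDegree_comp_le.trans ?_
      have := natDegree_C_mul_le (q : ℝ) (X : ℝ[X])
      rw [natDegree_X] at this
      simpa using Nat.mul_le_mul_left f.natDegree this
  have ht := (F.div_tendsto_atTop_zero_of_degree_lt (X ^ D) hF).comp tendsto_natCast_atTop_atTop
  have hev := (ht.eventually (gt_mem_nhds (zero_lt_one' ℝ))).and (Filter.eventually_gt_atTop 0)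
  obtain ⟨N, hN, hN0⟩ := hev.exists
  have hpos : (0 : ℝ) < (N : ℝ) ^ D := pow_pos (by exact_mod_cast hN0) D
  simp only [Function.comp_apply, eval_pow, eval_X, div_lt_one hpos] at hN
  have := h N
  simp only [F, eval_comp, eval_mul, eval_C, eval_X] at hN
  push_cast at this
  linarith

theorem intCast_finsum_mem_prod {V R : Type*} [Fintype V] [CommRing R] {S : Set (V → ℤ)}
    (hS : S.Finite) (b : V →₀ ℕ) :
    ((∑ᶠ a ∈ S, ∏ j, a j ^ b j : ℤ) : R) = ∑ᶠ a ∈ S, ∏ j, (a j : R) ^ b j := by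
  rw [finsum_mem_eq_finite_toFinset_sum _ hS, finsum_mem_eq_finite_toFinset_sum _ hS]
  push_cast
  rfl

theorem weightedEhrhart_monomial {V K : Type*} [Fintype V] [Field K] {P : Set (V → ℝ)}
    (hP : Bornology.IsBounded P) (b : V →₀ ℕ) (c : K) (n : ℕ) :
    weightedEhrhart P (MvPolynomial.monomial b c) n =
      c * ((∑ᶠ a ∈ dilateLatticePoints P n, ∏ j, a j ^ b j : ℤ) : K) := by
  have hS := dilateLatticePoints_finite hP n
  rw [intCast_finsum_mem_prod hS, weightedEhrhart, finsum_mem_eq_finite_toFinset_sum _ hS,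
    finsum_mem_eq_finite_toFinset_sum _ hS, Finset.mul_sum]
  refine Finset.sum_congr rfl fun a _ => ?_
  rw [MvPolynomial.eval_monomial, Finsupp.prod_fintype _ _ fun j => pow_zero _]

/-! ### Edge polytopes -/

/-- Both orientations of an edge are listed, so each generator occurs twice; lexicographic
maximality tolerates repetitions. Indexing by `Fin (m + 1)` provides the apex 0. -/
theorem exists_edge_enumeration {V : Type*} [Fintype V] [DecidableEq V] [Nonempty V]
    (G : SimpleGraph V) (hG : ∀ v : V, ¬ G.IsIsolated v) :
    ∃ (m : ℕ) (e : Fin (m + 1) → V × V), Set.range e = {p | G.Adj p.1 p.2} := by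
  classical
  obtain ⟨v⟩ := ‹Nonempty V›
  obtain ⟨w, hw⟩ : ∃ w, G.Adj v w := by
    by_contra! h
    exact hG v h
  let E := {p : V × V // G.Adj p.1 p.2}
  have hpos : 0 < Fintype.card E := Fintype.card_pos_iff.2 ⟨⟨(v, w), hw⟩⟩
  obtain ⟨m, hm⟩ := Nat.exists_eq_succ_of_ne_zero hpos.ne'
  let e : Fin (m + 1) ≃ E := (Fintype.equivFinOfCardEq hm).symm
  refine ⟨m, fun i => (e i).1, ?_⟩
  ext p
  constructor
  · rintro ⟨i, rfl⟩
    exact (e i).2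
  · intro hp
    exact ⟨e.symm ⟨p, hp⟩, by simp⟩

open Polynomial in
theorem exists_real_polynomial_edgePolytope {V : Type*} [Fintype V] [DecidableEq V] [Nonempty V]
    (G : SimpleGraph V) (hG : ∀ v : V, ¬ G.IsIsolated v) (b : V →₀ ℕ) :
    ∃ (k : ℕ) (f : ℝ[X]), k ≠ 0 ∧ k + numBipartiteComponents G = Fintype.card V ∧
      f.degree = (k - 1 + ∑ j, b j : ℕ) ∧
      ∀ n : ℕ, ((∑ᶠ a ∈ dilateLatticePoints (edgePolytope G) n, ∏ j, a j ^ b j : ℤ) : ℝ) =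
        f.eval (n : ℝ) := by
  obtain ⟨m, e, he⟩ := exists_edge_enumeration G hG
  have hadj : ∀ i, G.Adj (e i).1 (e i).2 := fun i => by
    have : e i ∈ Set.range e := ⟨i, rfl⟩
    rwa [he] at this
  have hex : ∀ {i j}, G.Adj i j → ∃ x, e x = (i, j) := fun {i j} h => by
    have : (i, j) ∈ Set.range e := by rw [he]; exact h
    exact this
  let v : Fin (m + 1) → V → ℤ := fun i => Pi.single (e i).1 1 + Pi.single (e i).2 1
  have hv0 : ∀ i j, 0 ≤ v i j := fun i j => by
    simp only [v, Pi.add_apply, Pi.single_apply]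
    split_ifs <;> norm_num
  have hv1 : ∀ i, v i (e i).1 ≠ 0 := fun i => by simp [v, (hadj i).ne]
  have hw : ∀ i, (fun j => (v i j : ℝ)) = Pi.single (e i).1 1 + Pi.single (e i).2 1 := fun i => by
    funext j
    simp [v, Pi.single_apply]
  have hP : edgePolytope G = convexHull ℝ (Set.range fun i j => (v i j : ℝ)) := by
    unfold edgePolytope
    congr 1
    ext x
    constructor
    · rintro ⟨i, j, hij, rfl⟩
      obtain ⟨y, hy⟩ := hex hij
      exact ⟨y, by simp only [hw, hy]⟩
    · rintro ⟨i, rfl⟩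
      exact ⟨_, _, hadj i, hw i⟩
  have hrank := G.finrank_span_edge_add_numBipartiteComponents
  have hrange : (Set.range fun p : {p : V × V // G.Adj p.1 p.2} =>
      (Pi.single p.1.1 1 + Pi.single p.1.2 1 : V → ℝ)) =
      Set.range fun i j => (v i j : ℝ) := by
    ext x
    constructor
    · rintro ⟨⟨⟨i, j⟩, hij⟩, rfl⟩
      obtain ⟨y, hy⟩ := hex hij
      exact ⟨y, by simp only [hw, hy]⟩
    · rintro ⟨i, rfl⟩
      exact ⟨⟨e i, hadj i⟩, (hw i).symm⟩
  rw [hrange] at hrank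
  let l : (V → ℝ) →ₗ[ℝ] ℝ := (2⁻¹ : ℝ) • ∑ j, LinearMap.proj j
  have hl : ∀ i, l (fun j => (v i j : ℝ)) = 1 := fun i => by
    rw [hw]
    simp [l, LinearMap.sum_apply, Finset.sum_add_distrib]
    norm_num
  -- A positive rank ensures that the truncated `k - 1` is the true difference in the degree
  -- formula.
  have hk0 : Module.finrank ℝ (Submodule.span ℝ (Set.range fun i j => (v i j : ℝ))) ≠ 0 := by
    rw [← Nat.pos_iff_ne_zero, Module.finrank_pos_iff]
    refine ⟨⟨0, ⟨_, Submodule.subset_span ⟨0, rfl⟩⟩, fun h => ?_⟩⟩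
    have h0 : (0 : V → ℝ) = fun j => (v 0 j : ℝ) := Subtype.ext_iff.1 h
    have h1 := hl 0
    rw [← h0, map_zero] at h1
    exact zero_ne_one h1
  have hS : ∀ n, (dilateLatticePoints (edgePolytope G) n).Finite :=
    dilateLatticePoints_finite (edgePolytope_isBounded G)
  obtain ⟨f, hf, hfe⟩ :=
    exists_polynomial_sum_dilateLatticePoints v l hl (MvPolynomial.monomial b 1)
  have hfe' : ∀ n : ℕ, ((∑ᶠ a ∈ dilateLatticePoints (edgePolytope G) n, ∏ j, a j ^ b j : ℤ) : ℝ) =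
      f.eval (n : ℝ) := by
    intro n
    rw [← hfe, intCast_finsum_mem_prod (hS n), hP]
    refine finsum_mem_congr rfl fun a _ => ?_
    rw [MvPolynomial.eval_monomial, one_mul, Finsupp.prod_fintype _ _ fun j => pow_zero _]
  rw [MvPolynomial.totalDegree_monomial _ one_ne_zero, Finsupp.sum_fintype _ _ fun _ => rfl,
    add_comm] at hf
  obtain ⟨k, hk⟩ : ∃ k, k = Module.finrank ℝ
    (Submodule.span ℝ (Set.range fun i j => (v i j : ℝ))) := ⟨_, rfl⟩
  rw [← hk] at hf hk0 hrank
  have hcov : ∀ j, ∃ i, v i j ≠ 0 := fun j => by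
    obtain ⟨w, hjw⟩ : ∃ w, G.Adj j w := by
      by_contra! h
      exact hG j h
    obtain ⟨y, hy⟩ := hex hjw
    have := hv1 y
    rw [hy] at this
    exact ⟨y, this⟩
  refine ⟨k, f, hk0, hrank, degree_eq_of_pow_le (q := 2 * k) hf fun N => ?_, hfe'⟩
  rw [← hfe', hP]
  exact_mod_cast pow_le_sum_dilateLatticePoints v hv0 hcov
    ⟨0, fun h => hv1 0 (congrFun h _)⟩ b hk N

theorem corollary2p2 {V : Type*} [Fintype V] [DecidableEq V] [Nonempty V]
    (G : SimpleGraph V) (hG : ∀ v : V, ¬ G.IsIsolated v)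
    {K : Type*} [Field K] [CharZero K]
    (w : MvPolynomial V K) (hw : ∃ (b : V →₀ ℕ) (c : K), c ≠ 0 ∧ w = MvPolynomial.monomial b c) :
    ∃ f : Polynomial K,
      (∀ n : ℕ, weightedEhrhart (edgePolytope G) w n = f.eval (n : K)) ∧
      f ≠ 0 ∧
      (f.natDegree : ℤ) =
        (Fintype.card V : ℤ) - (numBipartiteComponents G : ℤ) - 1 + (w.totalDegree : ℤ) := by
  obtain ⟨b, c, hc, rfl⟩ := hw
  obtain ⟨k, f, hk0, hk, hdeg, hf⟩ := exists_real_polynomial_edgePolytope G hG b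
  -- The field `K` need not be related to `ℝ`, but both contain `ℚ`, and extending scalars from `ℚ`
  -- preserves the degree.
  obtain ⟨g, hg, rfl⟩ := exists_rat_polynomial_map_eq hf
  rw [Polynomial.degree_map] at hdeg
  have hdeg' : (Polynomial.C c * g.map (algebraMap ℚ K)).degree = (k - 1 + ∑ j, b j : ℕ) := by
    rw [Polynomial.degree_C_mul hc, Polynomial.degree_map, hdeg]
  refine ⟨Polynomial.C c * g.map (algebraMap ℚ K), fun n => ?_, fun h => ?_, ?_⟩
  · rw [weightedEhrhart_monomial (edgePolytope_isBounded G), Polynomial.eval_mul,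
      Polynomial.eval_C, ← map_natCast (algebraMap ℚ K), Polynomial.eval_map_algebraMap,
      Polynomial.aeval_algebraMap_apply, Polynomial.coe_aeval_eq_eval, ← hg, map_intCast]
  · rw [h, Polynomial.degree_zero] at hdeg'
    exact WithBot.bot_ne_natCast _ hdeg'
  · rw [Polynomial.natDegree_eq_of_degree_eq_some hdeg', MvPolynomial.totalDegree_monomial _ hc,
      Finsupp.sum_fintype _ _ fun _ => rfl]
    omega
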